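/- Let $k\ge 1$ and $m\ge 1$ be integers. Let $V$ be the real vector space with basis the simple roots $\alpha_1,\dots,\alpha_k$ of type $A_k$ and symmetric bilinear form $\langle\alpha_i,\alpha_i\rangle=2$, $\langle\alpha_i,\alpha_j\rangle=-1$ if $|i-j|=1$, and $0$ otherwise. Put $\phi=\alpha_1+\dots+\alpha_k$ and $H_{v,p}=\{x\in V:\langle v,x\rangle=p\}$. Let $W$ be the group generated by the reflections $s_i$ in $H_{\alpha_i,0}$ for $1\le i\le k$ and the reflection $s_0$ in $H_{\phi,1}$; let $C=\{x:\langle\alpha_i,x\rangle\ge 0\text{ for all }i\}$ be the closed dominant chamber, $A_\emptyset=\{x\in C:\langle\phi,x\rangle\le 1\}$ the fundamental alcove, and $A_w=w^{-1}A_\emptyset$ for $w\in W$. The group $W$ acts on $(k+1)$-cores (partitions without a removable rim hook of length $k+1$): if a core $\mu$ has an addable cell of residue $i$ (the residue of a cell being its column index minus its row index modulo $k+1$), then $s_i\mu$ is $\mu$ with all addable cells of residue $i$ added; otherwise $s_i\mu$ is $\mu$ with all removable cells of residue $i$ (possibly none) removed. For a $(k+1)$-core $\mu$ let $\mathfrak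 p(\mu)$ be the partition whose $a$-th part is the number of cells in row $a$ of $\mu$ with hook length less than $k+1$. A partition is $k$-bounded if all its parts are at most $k$; a $k$-bounded partition $\lambda$ corresponds to the alcove $A_w\subseteq C$ if $\lambda=\mathfrak p(w\emptyset)$. For $1\le i\le k$ let $R_i=(i^{\,k+1-i})$ be the rectangular partition with $k+1-i$ parts equal to $i$. For partitions $\lambda,\mu$ let $\lambda\cup\mu$ be the partition obtained by arranging the parts of both in non-increasing order, and let $\lambda\subseteq\mu$ denote containment of Young diagrams. **Corollary.** Let $\lambda$ be a $k$-bounded partition that corresponds to an alcove $A_w\subseteq C$ lying below $H_{\phi,m}$, that is, $\langle\phi,x\rangle\le m$ for all $x\in A_w$. Then there are $i_1,\dots,i_{m-1}\in\{1,\dots,k\}$ such that $\lambda\subseteq R_{i_1}\cup\dots\cup R_{i_{m-1}}$ (for $m=1$ the union is the empty partition). -/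

import Mathlib

noncomputable section

/-! ### The affine reflection group of type `A_k` -/

namespace AffineA

/-- The space `V`: a vector `x` stands for `∑ i, x i • α_i`, where `α_0, …, α_{k-1}` are the
simple roots of type `A_k` (numbered from `0` instead of from `1`). -/
abbrev V (k : ℕ) : Type := Fin k → ℝ

/-- The symmetric bilinear form with `⟨α_i, α_i⟩ = 2`, `⟨α_i, α_{i±1}⟩ = -1` and `0` otherwise. -/
def form (k : ℕ) : LinearMap.BilinForm ℝ (V k) :=
  Matrix.toBilin' (Matrix.of fun i j : Fin k =>
    if i = j then (2 : ℝ) else if (i : ℕ) + 1 = j ∨ (j : ℕ) + 1 = i then -1 else 0)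

/-- The simple root `α_i`. -/
def simpleRoot (k : ℕ) (i : Fin k) : V k := Pi.single i 1

/-- The highest root `φ = α_1 + ⋯ + α_k`. -/
def highestRoot (k : ℕ) : V k := ∑ i, simpleRoot k i

/-- The orthogonal reflection `x ↦ x - (2 (⟨v, x⟩ - p) / ⟨v, v⟩) v` in the hyperplane
`H_{v,p} = {x | ⟨v, x⟩ = p}`. -/
def hyperplaneReflection (k : ℕ) (v : V k) (p : ℝ) : Equiv.Perm (V k) :=
  Function.Involutive.toPerm
    (fun x => x - (2 * (form k v x - p) / form k v v) • v) (by
      intro x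
      by_cases h : form k v v = 0
      · simp [h]
      · simp only [map_sub, map_smul, smul_eq_mul]
        rw [sub_sub, ← add_smul, sub_eq_self]
        have : 2 * (form k v x - p) / form k v v +
            2 * (form k v x - 2 * (form k v x - p) / form k v v * form k v v - p) /
              form k v v = 0 := by
          field_simp
          ring
        rw [this, zero_smul])

/-- The generators: `s_0` is the reflection in `H_{φ,1}`, and `s_i`, for `1 ≤ i ≤ k`, the
reflection in `H_{α_i,0}`. -/
def gen (k : ℕ) : Fin (k + 1) → Equiv.Perm (V k) :=
  Fin.cases (hyperplaneReflection k (highestRoot k) 1)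
    (fun i => hyperplaneReflection k (simpleRoot k i) 0)

/-- The affine reflection group `W`, acting faithfully on `V`. -/
def W (k : ℕ) : Subgroup (Equiv.Perm (V k)) := Subgroup.closure (Set.range (gen k))

/-- The closed dominant chamber. -/
def dominantChamber (k : ℕ) : Set (V k) := {x | ∀ i, 0 ≤ form k (simpleRoot k i) x}

/-- The (closed) fundamental alcove. -/
def fundamentalAlcove (k : ℕ) : Set (V k) :=
  {x | x ∈ dominantChamber k ∧ form k (highestRoot k) x ≤ 1}

/-- The alcove `A_w = w⁻¹ A_∅`. -/
def alcove (k : ℕ) (w : W k) : Set (V k) :=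
  (fun x => (w⁻¹ : Equiv.Perm (V k)) x) '' fundamentalAlcove k

/-- The points on or below the hyperplane `H_{φ,m}`. -/
def below (k m : ℕ) : Set (V k) := {x | form k (highestRoot k) x ≤ m}

end AffineA

/-! ### Partitions

Partitions are Young diagrams; the cell `(a, b)` lies in row `a` and column `b`, counted from
`0`. -/

namespace KBounded

/-- The addable cells of `μ`: the cells outside `μ` whose addition gives a Young diagram. The box
in which they are searched is no restriction, see `mem_addable`. -/
def addable (μ : YoungDiagram) : Finset (ℕ × ℕ) :=
  open Classical in
  (Finset.range (μ.colLen 0 + 1) ×ˢ Finset.range (μ.rowLen 0 + 1)).filter fun c =>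
    c ∉ μ ∧ IsLowerSet (insert c (μ.cells : Set (ℕ × ℕ)))

theorem mem_addable (μ : YoungDiagram) (c : ℕ × ℕ) :
    c ∈ addable μ ↔ c ∉ μ ∧ IsLowerSet (insert c (μ.cells : Set (ℕ × ℕ))) := by
  classical
  simp only [addable, Finset.mem_filter, Finset.mem_product, Finset.mem_range,
    and_iff_right_iff_imp]
  rintro ⟨-, h⟩
  obtain ⟨a, b⟩ := c
  constructor
  · by_contra hlt
    have hlt : μ.colLen 0 + 1 ≤ a := by simpa using hlt
    have h1 := h (show ((a - 1, 0) : ℕ × ℕ) ≤ (a, b) from ⟨by simp, by simp⟩)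
      (Set.mem_insert _ _)
    rcases h1 with h1 | h1
    · have := congrArg Prod.fst h1
      simp at this
      omega
    · have h2 : (a - 1, 0) ∈ μ := h1
      rw [YoungDiagram.mem_iff_lt_colLen] at h2
      omega
  · by_contra hlt
    have hlt : μ.rowLen 0 + 1 ≤ b := by simpa using hlt
    have h1 := h (show ((0, b - 1) : ℕ × ℕ) ≤ (a, b) from ⟨by simp, by simp⟩)
      (Set.mem_insert _ _)
    rcases h1 with h1 | h1
    · have := congrArg Prod.snd h1
      simp at this
      omega
    · have h2 : (0, b - 1) ∈ μ := h1
      rw [YoungDiagram.mem_iff_lt_rowLen] at h2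
      omega

/-- The removable cells of `μ`: the cells of `μ` whose removal gives a Young diagram. -/
def removable (μ : YoungDiagram) : Finset (ℕ × ℕ) :=
  open Classical in
  μ.cells.filter fun c => IsLowerSet ((μ.cells : Set (ℕ × ℕ)) \ {c})

/-- The cell `c` has content (column minus row) congruent to `r` modulo `k + 1`. -/
def HasResidue (k : ℕ) (r : Fin (k + 1)) (c : ℕ × ℕ) : Prop :=
  (c.2 : ℤ) - (c.1 : ℤ) ≡ (r : ℤ) [ZMOD (k + 1 : ℤ)]

/-- The addable cells of residue `r`. -/
def addableRes (k : ℕ) (r : Fin (k + 1)) (μ : YoungDiagram) : Finset (ℕ × ℕ) :=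
  open Classical in (addable μ).filter (HasResidue k r)

/-- The removable cells of residue `r`. -/
def removableRes (k : ℕ) (r : Fin (k + 1)) (μ : YoungDiagram) : Finset (ℕ × ℕ) :=
  open Classical in (removable μ).filter (HasResidue k r)

/-- `μ` with all its addable cells of residue `r` added. -/
def addAll (k : ℕ) (r : Fin (k + 1)) (μ : YoungDiagram) : YoungDiagram where
  cells := μ.cells ∪ addableRes k r μ
  isLowerSet := by
    classical
    intro a b hba ha
    simp only [Finset.coe_union, Set.mem_union, Finset.mem_coe] at ha ⊢
    rcases ha with ha | ha
    · exact Or.inl (μ.isLowerSet hba ha)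
    · have h := ((mem_addable μ a).1 (Finset.mem_filter.1 ha).1).2 hba (Set.mem_insert _ _)
      rcases h with rfl | h
      · exact Or.inr ha
      · exact Or.inl h

/-- `μ` with all its removable cells of residue `r` removed. -/
def removeAll (k : ℕ) (r : Fin (k + 1)) (μ : YoungDiagram) : YoungDiagram where
  cells := μ.cells \ removableRes k r μ
  isLowerSet := by
    classical
    intro a b hba ha
    simp only [Finset.coe_sdiff, Set.mem_sdiff, Finset.mem_coe] at ha ⊢
    refine ⟨μ.isLowerSet hba ha.1, fun hb => ?_⟩
    have h := (Finset.mem_filter.1 (Finset.mem_filter.1 hb).1).2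
    have hab : a ≠ b := by
      rintro rfl
      exact ha.2 hb
    exact (h hba ⟨ha.1, by simpa using hab⟩).2 rfl

/-- The action of the generator `s_r` on `(k+1)`-cores: add all addable cells of residue `r` if
there are any; otherwise remove all removable cells of residue `r` (this is `μ` itself if there
are none). It is only ever applied to diagrams obtained from the empty one by such steps, all of
which are `(k+1)`-cores. -/
def coreGen (k : ℕ) (r : Fin (k + 1)) (μ : YoungDiagram) : YoungDiagram :=
  open Classical in
  if (addableRes k r μ).Nonempty then addAll k r μ else removeAll k r μ

/-- `μ = w ∅`: for some expression `w = s_{a_1} ⋯ s_{a_n}`, the diagram `μ` is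
`s_{a_1} (⋯ (s_{a_n} ∅))`. -/
def IsCoreOf (k : ℕ) (w : AffineA.W k) (μ : YoungDiagram) : Prop :=
  ∃ l : List (Fin (k + 1)),
    (l.map (AffineA.gen k)).prod = (w : Equiv.Perm (AffineA.V k)) ∧
      l.foldr (coreGen k) ⊥ = μ

/-- The hook length of a cell `(a, b)` of `μ`. -/
def hook (μ : YoungDiagram) (a b : ℕ) : ℕ := (μ.rowLen a - b) + (μ.colLen b - a) - 1

/-- The number of cells in row `a` of `μ` with hook length less than `k + 1`. -/
def shortHooks (k : ℕ) (μ : YoungDiagram) (a : ℕ) : ℕ :=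
  ((Finset.range (μ.rowLen a)).filter fun b => hook μ a b < k + 1).card

/-- The partition `lam` corresponds to the alcove `A_w`: it is the image `𝔭(w ∅)` of the core `w ∅`
under the map that counts in each row the cells with hook length less than `k + 1`. -/
def CorrespondsTo (k : ℕ) (lam : YoungDiagram) (w : AffineA.W k) : Prop :=
  ∃ μ, IsCoreOf k w μ ∧ ∀ a, lam.rowLen a = shortHooks k μ a

/-- All parts are at most `k`. -/
def IsKBounded (k : ℕ) (lam : YoungDiagram) : Prop := ∀ a, lam.rowLen a ≤ k

/-- The rectangle `R_i = (i^{k+1-i})`, for `1 ≤ i ≤ k`: `k + 1 - i` rows of length `i`. -/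
def rect (k i : ℕ) : YoungDiagram where
  cells := Finset.range (k + 1 - i) ×ˢ Finset.range i
  isLowerSet := by
    intro a b hba ha
    simp only [Finset.mem_coe, Finset.mem_product, Finset.mem_range] at ha ⊢
    exact ⟨lt_of_le_of_lt hba.1 ha.1, lt_of_le_of_lt hba.2 ha.2⟩

/-- The union `lam ∪ mu` of partitions: the parts of both, arranged in non-increasing order. -/
def union (lam mu : YoungDiagram) : YoungDiagram :=
  YoungDiagram.ofRowLens (Multiset.sort (lam.rowLens + mu.rowLens : Multiset ℕ) (· ≥ ·))
    (Multiset.pairwise_sort _ _).sortedGE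

/-- The union `R_{i_1} ∪ ⋯ ∪ R_{i_n}`; it is empty for `n = 0`. -/
def rectUnion (k : ℕ) {n : ℕ} (i : Fin n → ℕ) : YoungDiagram :=
  (List.ofFn fun j => rect k (i j)).foldr union ⊥

end KBounded

end

/-! Write n = k + 1. In Euclidean coordinates extended n-periodically up to a shift, every generator
of `W` exchanges neighbouring positions (`coord_gen`), so a word for w gives an affine permutation u
of ℤ with u(j + n) = u(j) + n. Testing at the image of the barycentre, dominance gives u(0) ≤ ... ≤
u(k), and lying below the hyperplane gives u(k) - u(0) ≤ nm. Equality would violate injectivity of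
u, so ⌊(u(k) - u(0))/n⌋ ≤ m - 1.

The same u acts on Maya diagrams: the beads of the core w∅ are the u(j) with j < 0 (`isBead_foldr`).
Short hooks in a row are gaps less than n below its bead, in distinct classes modulo n, whence
column b of λ has length at most the sum over i > b of ⌊(u(i) - u(b))/n⌋ (`colLen_le_sum`).

Put F(j) = ⌊(u(j) - u(0))/n⌋. Floors are superadditive, so the bound is at most the sum of F(j) -
F(b) over j > b. Slicing this sum by level t < m - 1 gives one rectangle per level
(`exists_rect_indices`). Column lengths add under union of partitions, so comparing columns gives
the containment. -/

noncomputable section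

/-! ### The bilinear form in simple-root coefficients -/

namespace AffineA

/-- The coefficient of the `j`-th simple root, extended by zero to all integers `j`. -/
def coeff {k : ℕ} (x : V k) (j : ℤ) : ℝ := ∑ i : Fin k, if (i : ℤ) = j then x i else 0

theorem coeff_coe {k : ℕ} (x : V k) (i : Fin k) : coeff x i = x i := by
  unfold coeff
  rw [Finset.sum_eq_single i]
  · simp
  · intro b _ hb
    rw [if_neg]
    intro h
    exact hb (Fin.ext (by exact_mod_cast h))
  · simp

theorem coeff_of_neg {k : ℕ} (x : V k) {j : ℤ} (hj : j < 0) : coeff x j = 0 :=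
  Finset.sum_eq_zero fun i _ => if_neg (by omega)

theorem coeff_of_ge {k : ℕ} (x : V k) {j : ℤ} (hj : k ≤ j) : coeff x j = 0 :=
  Finset.sum_eq_zero fun i _ => if_neg (by have := i.isLt; omega)

theorem coeff_sub_smul {k : ℕ} (x v : V k) (c : ℝ) (j : ℤ) :
    coeff (x - c • v) j = coeff x j - c * coeff v j := by
  unfold coeff
  rw [Finset.mul_sum, ← Finset.sum_sub_distrib]
  refine Finset.sum_congr rfl fun i _ => ?_
  split_ifs <;> simp

theorem coeff_simpleRoot {k : ℕ} (i : Fin k) (j : ℤ) :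
    coeff (simpleRoot k i) j = if j = i then 1 else 0 := by
  unfold coeff simpleRoot
  rw [Finset.sum_eq_single i]
  · simp [eq_comm]
  · intro b _ hb
    simp [hb]
  · simp

theorem highestRoot_apply {k : ℕ} (i : Fin k) : highestRoot k i = 1 := by
  simp [highestRoot, simpleRoot, Finset.sum_apply, Pi.single_apply]

theorem coeff_highestRoot {k : ℕ} {j : ℤ} (h0 : 0 ≤ j) (hk : j < k) :
    coeff (highestRoot k) j = 1 := by
  lift j to ℕ using h0
  have := coeff_coe (highestRoot k) ⟨j, by exact_mod_cast hk⟩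
  rw [highestRoot_apply] at this
  exact this

theorem form_simpleRoot {k : ℕ} (i : Fin k) (x : V k) :
    form k (simpleRoot k i) x = 2 * coeff x i - coeff x (i - 1) - coeff x (i + 1) := by
  unfold form simpleRoot coeff
  rw [Matrix.toBilin'_apply, Finset.sum_eq_single i]
  · rw [Finset.mul_sum, ← Finset.sum_sub_distrib, ← Finset.sum_sub_distrib]
    refine Finset.sum_congr rfl fun j _ => ?_
    simp only [Pi.single_eq_same, one_mul, Matrix.of_apply]
    rcases eq_or_ne i j with rfl | hij
    · rw [if_pos rfl, if_pos rfl, if_neg (by omega), if_neg (by omega)]; ring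
    · have hij' : (i : ℕ) ≠ j := fun h => hij (Fin.ext h)
      rw [if_neg hij, if_neg (by omega : ¬ ((j : ℕ) : ℤ) = i)]
      by_cases h1 : (i : ℕ) + 1 = j
      · rw [if_pos (Or.inl h1), if_neg (by omega), if_pos (by omega)]; ring
      · by_cases h2 : (j : ℕ) + 1 = i
        · rw [if_pos (Or.inr h2), if_pos (by omega), if_neg (by omega)]; ring
        · rw [if_neg (by tauto), if_neg (by omega), if_neg (by omega)]; ring
  · intro b _ hb
    simp [hb]
  · simp

/-- Summing the second differences of `form_simpleRoot` telescopes; only the two ends survive. -/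
theorem form_highestRoot {k : ℕ} (x : V k) :
    form k (highestRoot k) x = coeff x 0 + coeff x (k - 1) := by
  have h : form k (highestRoot k) x = ∑ i : Fin k, form k (simpleRoot k i) x := by
    simp [highestRoot, LinearMap.sum_apply]
  rw [h]
  simp only [form_simpleRoot]
  rw [Fin.sum_univ_eq_sum_range
    (fun i : ℕ => 2 * coeff x i - coeff x ((i : ℤ) - 1) - coeff x ((i : ℤ) + 1)) k]
  have h2 := Finset.sum_range_sub' (fun i : ℕ => coeff x i - coeff x ((i : ℤ) - 1)) k
  rw [coeff_of_ge x (le_refl (k : ℤ)), Nat.cast_zero,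
    coeff_of_neg x (show (0 : ℤ) - 1 < 0 by norm_num)] at h2
  rw [show coeff x 0 + coeff x (k - 1) = coeff x 0 - 0 - (0 - coeff x (k - 1)) by ring, ← h2]
  refine Finset.sum_congr rfl fun i _ => ?_
  push_cast
  rw [add_sub_cancel_right]
  ring

theorem form_simpleRoot_self {k : ℕ} (i : Fin k) :
    form k (simpleRoot k i) (simpleRoot k i) = 2 := by
  rw [form_simpleRoot]
  simp [coeff_simpleRoot]

theorem form_highestRoot_self {k : ℕ} (hk : 1 ≤ k) :
    form k (highestRoot k) (highestRoot k) = 2 := by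
  rw [form_highestRoot, coeff_highestRoot le_rfl (by omega),
    coeff_highestRoot (by omega) (by omega)]
  norm_num

theorem gen_zero_apply {k : ℕ} (hk : 1 ≤ k) (x : V k) :
    gen k 0 x = x - (form k (highestRoot k) x - 1) • highestRoot k := by
  change x - (2 * (form k (highestRoot k) x - 1) / form k (highestRoot k) (highestRoot k)) •
    highestRoot k = _
  rw [form_highestRoot_self hk, mul_div_cancel_left₀ _ two_ne_zero]

theorem gen_succ_apply {k : ℕ} (i : Fin k) (x : V k) :
    gen k i.succ x = x - form k (simpleRoot k i) x • simpleRoot k i := by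
  change x - (2 * (form k (simpleRoot k i) x - 0) / form k (simpleRoot k i) (simpleRoot k i)) •
    simpleRoot k i = _
  rw [form_simpleRoot_self, sub_zero, mul_div_cancel_left₀ _ two_ne_zero]

/-! ### Generators as affine permutations of coordinates -/

/-- The Euclidean coordinates of `x`, where `α_j = e_j - e_{j+1}`, extended to all integers by
`coord x (j + (k + 1)) = coord x j - 1`. -/
def coord {k : ℕ} (x : V k) (j : ℤ) : ℝ :=
  coeff x (j % (k + 1)) - coeff x (j % (k + 1) - 1) - ((j / (k + 1) : ℤ) : ℝ)

theorem coord_add_mul {k : ℕ} (x : V k) {p : ℤ} (q : ℤ) (h0 : 0 ≤ p) (hk : p ≤ k) :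
    coord x (p + (k + 1) * q) = coeff x p - coeff x (p - 1) - q := by
  have hn : (k + 1 : ℤ) ≠ 0 := by omega
  unfold coord
  rw [Int.add_mul_emod_self_left, Int.emod_eq_of_lt h0 (by omega), Int.add_mul_ediv_left _ _ hn,
    Int.ediv_eq_zero_of_lt h0 (by omega), zero_add]

theorem coord_of_mem {k : ℕ} (x : V k) {p : ℤ} (h0 : 0 ≤ p) (hk : p ≤ k) :
    coord x p = coeff x p - coeff x (p - 1) := by
  simpa using coord_add_mul x 0 h0 hk

theorem form_simpleRoot_eq_coord {k : ℕ} (i : Fin k) (x : V k) :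
    form k (simpleRoot k i) x = coord x i - coord x (i + 1) := by
  have := i.isLt
  rw [form_simpleRoot, coord_of_mem x (by omega) (by omega), coord_of_mem x (by omega) (by omega),
    add_sub_cancel_right]
  ring

theorem form_highestRoot_eq_coord {k : ℕ} (x : V k) :
    form k (highestRoot k) x = coord x 0 - coord x k := by
  rw [form_highestRoot, coord_of_mem x le_rfl (by omega), coord_of_mem x (by omega) le_rfl,
    coeff_of_ge x le_rfl, coeff_of_neg x (show (0 : ℤ) - 1 < 0 by norm_num)]
  ring

open Classical in
/-- The function exchanging `j - 1` and `j` for every integer `j ≡ r` modulo `k + 1`. -/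
def swapFun (k : ℕ) (r : Fin (k + 1)) (j : ℤ) : ℤ :=
  if (k + 1 : ℤ) ∣ j - r then j - 1 else if (k + 1 : ℤ) ∣ j + 1 - r then j + 1 else j

theorem swapFun_of_dvd {k : ℕ} {r : Fin (k + 1)} {j : ℤ} (h : (k + 1 : ℤ) ∣ j - r) :
    swapFun k r j = j - 1 := if_pos h

theorem not_dvd_of_dvd_add_one {k : ℕ} (hk : 1 ≤ k) {a : ℤ} (h : (k + 1 : ℤ) ∣ a + 1) :
    ¬ (k + 1 : ℤ) ∣ a := by
  intro h'
  have := Int.le_of_dvd one_pos ((Int.dvd_add_right h').1 h)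
  omega

theorem swapFun_of_dvd_add_one {k : ℕ} (hk : 1 ≤ k) {r : Fin (k + 1)} {j : ℤ}
    (h : (k + 1 : ℤ) ∣ j + 1 - r) : swapFun k r j = j + 1 := by
  unfold swapFun
  rw [if_neg, if_pos h]
  apply not_dvd_of_dvd_add_one hk
  rwa [sub_add_eq_add_sub]

theorem swapFun_of_not_dvd {k : ℕ} {r : Fin (k + 1)} {j : ℤ} (h : ¬ (k + 1 : ℤ) ∣ j - r)
    (h' : ¬ (k + 1 : ℤ) ∣ j + 1 - r) : swapFun k r j = j := by
  unfold swapFun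
  rw [if_neg h, if_neg h']

theorem swapFun_involutive {k : ℕ} (hk : 1 ≤ k) (r : Fin (k + 1)) :
    Function.Involutive (swapFun k r) := by
  intro j
  by_cases h : (k + 1 : ℤ) ∣ j - r
  · rw [swapFun_of_dvd h, swapFun_of_dvd_add_one hk (by simpa using h), sub_add_cancel]
  · by_cases h' : (k + 1 : ℤ) ∣ j + 1 - r
    · rw [swapFun_of_dvd_add_one hk h', swapFun_of_dvd h', add_sub_cancel_right]
    · rw [swapFun_of_not_dvd h h', swapFun_of_not_dvd h h']

theorem swapFun_add_mul (k : ℕ) (r : Fin (k + 1)) (j q : ℤ) :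
    swapFun k r (j + (k + 1) * q) = swapFun k r j + (k + 1) * q := by
  unfold swapFun
  have h1 : (k + 1 : ℤ) ∣ j + (k + 1) * q - r ↔ (k + 1 : ℤ) ∣ j - r := by
    rw [add_sub_right_comm, Int.dvd_add_left (Dvd.intro _ rfl)]
  have h2 : (k + 1 : ℤ) ∣ j + (k + 1) * q + 1 - r ↔ (k + 1 : ℤ) ∣ j + 1 - r := by
    rw [add_right_comm, add_sub_right_comm, Int.dvd_add_left (Dvd.intro _ rfl)]
  simp only [h1, h2]
  split_ifs <;> ring

theorem dvd_iff_eq_zero {k : ℕ} {a : ℤ} (h1 : -k ≤ a) (h2 : a ≤ k) : (k + 1 : ℤ) ∣ a ↔ a = 0 :=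
  ⟨fun h => Int.eq_zero_of_abs_lt_dvd h (by rw [abs_lt]; omega), fun h => h ▸ dvd_zero _⟩

/-- The shift by 1 in the extension of the coordinates absorbs the translation part of s_0, so s_0
behaves like the other generators. -/
theorem coord_gen {k : ℕ} (hk : 1 ≤ k) (r : Fin (k + 1)) (x : V k) (j : ℤ) :
    coord (gen k r x) j = coord x (swapFun k r j) := by
  obtain ⟨p, q, rfl, h0, hp⟩ : ∃ p q : ℤ, j = p + (k + 1) * q ∧ 0 ≤ p ∧ p ≤ k :=
    ⟨j % (k + 1), j / (k + 1), (Int.emod_add_mul_ediv _ _).symm, Int.emod_nonneg _ (by omega),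
      by have := Int.emod_lt_of_pos j (show (0 : ℤ) < k + 1 by omega); omega⟩
  rw [coord_add_mul _ _ h0 hp, swapFun_add_mul]
  refine Fin.cases ?_ (fun i => ?_) r
  · rw [gen_zero_apply hk, coeff_sub_smul, coeff_sub_smul, form_highestRoot]
    rcases eq_or_ne p 0 with rfl | h0'
    · rw [swapFun_of_dvd (by simp), show (0 : ℤ) - 1 + (k + 1) * q = k + (k + 1) * (q - 1) by ring,
        coord_add_mul _ _ (by omega) le_rfl, coeff_of_ge x le_rfl,
        coeff_highestRoot le_rfl (by omega), coeff_of_neg x (show (0 : ℤ) - 1 < 0 by norm_num),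
        coeff_of_neg (highestRoot k) (show (0 : ℤ) - 1 < 0 by norm_num)]
      push_cast
      ring
    · rcases eq_or_ne p k with rfl | hpk
      · rw [swapFun_of_dvd_add_one hk (by simp),
          show (k : ℤ) + 1 + (k + 1) * q = 0 + (k + 1) * (q + 1) by ring,
          coord_add_mul _ _ le_rfl (by omega), coeff_of_ge x le_rfl, coeff_of_ge _ le_rfl,
          coeff_highestRoot (by omega) (by omega),
          coeff_of_neg x (show (0 : ℤ) - 1 < 0 by norm_num)]
        push_cast
        ring
      · rw [swapFun_of_not_dvd, coord_add_mul _ _ h0 hp, coeff_highestRoot h0 (by omega),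
          coeff_highestRoot (by omega) (by omega)]
        · ring
        · rw [dvd_iff_eq_zero] <;> simp <;> omega
        · rw [dvd_iff_eq_zero] <;> simp <;> omega
  · have hi := i.isLt
    rw [gen_succ_apply, coeff_sub_smul, coeff_sub_smul, form_simpleRoot, coeff_simpleRoot,
      coeff_simpleRoot]
    rcases eq_or_ne p i with rfl | h1
    · rw [swapFun_of_dvd_add_one hk (by simp), coord_add_mul _ _ (by omega) (by omega),
        if_pos rfl, if_neg (by omega), add_sub_cancel_right]
      ring
    · rcases eq_or_ne p (i + 1) with rfl | h2
      · rw [swapFun_of_dvd (by simp), add_sub_cancel_right, coord_add_mul _ _ (by omega) (by omega),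
          if_neg (by omega), if_pos rfl]
        ring
      · rw [swapFun_of_not_dvd, coord_add_mul _ _ h0 hp, if_neg h1, if_neg (by omega)]
        · ring
        · rw [dvd_iff_eq_zero] <;> simp <;> omega
        · rw [dvd_iff_eq_zero] <;> simp <;> omega

/-! ### The alcove conditions as inequalities for the affine permutation -/

/-- The barycentre of the fundamental alcove. -/
def barycentre (k : ℕ) : V k := fun i => (i + 1) * (k - i) / (2 * (k + 1))

theorem coeff_barycentre {k : ℕ} {j : ℤ} (h0 : -1 ≤ j) (hk : j ≤ k) :
    coeff (barycentre k) j = (j + 1) * (k - j) / (2 * (k + 1)) := by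
  rcases h0.eq_or_lt with rfl | h0
  · rw [coeff_of_neg _ (by norm_num)]; simp
  rcases hk.eq_or_lt with rfl | hk
  · rw [coeff_of_ge _ le_rfl]; simp
  lift j to ℕ using by omega
  exact coeff_coe (barycentre k) ⟨j, by omega⟩

/-- These coordinates are affine in j with slope -1/(k + 1), so comparing coordinates of a moved
barycentre amounts to comparing values of the permutation. -/
theorem coord_barycentre {k : ℕ} (j : ℤ) :
    coord (barycentre k) j = (k / 2 - j) / (k + 1) := by
  obtain ⟨p, q, rfl, h0, hp⟩ : ∃ p q : ℤ, j = p + (k + 1) * q ∧ 0 ≤ p ∧ p ≤ k :=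
    ⟨j % (k + 1), j / (k + 1), (Int.emod_add_mul_ediv _ _).symm, Int.emod_nonneg _ (by omega),
      by have := Int.emod_lt_of_pos j (show (0 : ℤ) < k + 1 by omega); omega⟩
  have : (k + 1 : ℝ) ≠ 0 := by positivity
  rw [coord_add_mul _ _ h0 hp, coeff_barycentre (by omega) (by omega),
    coeff_barycentre (by omega) (by omega)]
  push_cast
  field_simp
  ring

theorem barycentre_mem (k : ℕ) : barycentre k ∈ fundamentalAlcove k := by
  have : (0 : ℝ) < k + 1 := by positivity
  constructor
  · intro i
    rw [form_simpleRoot_eq_coord, coord_barycentre, coord_barycentre, ← sub_div]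
    push_cast
    apply div_nonneg _ this.le
    linarith
  · rw [form_highestRoot_eq_coord, coord_barycentre, coord_barycentre, ← sub_div, div_le_one this]
    push_cast
    linarith

/-- The affine permutation of the integers given by a word in the generators. -/
def wordPerm {k : ℕ} (hk : 1 ≤ k) (l : List (Fin (k + 1))) : Equiv.Perm ℤ :=
  (l.map fun r => (swapFun_involutive hk r).toPerm).prod

theorem wordPerm_cons {k : ℕ} (hk : 1 ≤ k) (r : Fin (k + 1)) (l : List (Fin (k + 1))) (j : ℤ) :
    wordPerm hk (r :: l) j = swapFun k r (wordPerm hk l j) := rfl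

theorem wordPerm_add_mul {k : ℕ} (hk : 1 ≤ k) (l : List (Fin (k + 1))) (j q : ℤ) :
    wordPerm hk l (j + (k + 1) * q) = wordPerm hk l j + (k + 1) * q := by
  induction l with
  | nil => rfl
  | cons r l ih => rw [wordPerm_cons, wordPerm_cons, ih, swapFun_add_mul]

theorem coord_wordPerm {k : ℕ} (hk : 1 ≤ k) (l : List (Fin (k + 1))) (y : V k) (j : ℤ) :
    coord ((l.map (gen k)).prod y) (wordPerm hk l j) = coord y j := by
  induction l with
  | nil => rfl
  | cons r l ih =>
    rw [wordPerm_cons, List.map_cons, List.prod_cons, Equiv.Perm.mul_apply, coord_gen hk,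
      swapFun_involutive hk, ih]

theorem coord_inv_barycentre {k : ℕ} (hk : 1 ≤ k) (l : List (Fin (k + 1))) (w : W k)
    (hl : (l.map (gen k)).prod = w) (j : ℤ) :
    coord ((w⁻¹ : Equiv.Perm (V k)) (barycentre k)) j =
      (k / 2 - (wordPerm hk l j : ℤ)) / (k + 1) := by
  rw [← coord_wordPerm hk l, hl, ← Equiv.Perm.mul_apply, mul_inv_cancel, Equiv.Perm.one_apply,
    coord_barycentre]

/-- The barycentre is the only point of the alcove that has to be tested. -/
theorem wordPerm_le_succ_of_dominant {k : ℕ} (hk : 1 ≤ k) (l : List (Fin (k + 1))) (w : W k)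
    (hl : (l.map (gen k)).prod = w) (hdom : alcove k w ⊆ dominantChamber k) (i : Fin k) :
    wordPerm hk l i ≤ wordPerm hk l (i + 1) := by
  have h := hdom (Set.mem_image_of_mem _ (barycentre_mem k)) i
  have : (0 : ℝ) < k + 1 := by positivity
  rw [form_simpleRoot_eq_coord, coord_inv_barycentre hk l w hl, coord_inv_barycentre hk l w hl,
    ← sub_div, le_div_iff₀ this, zero_mul] at h
  have : (wordPerm hk l i : ℝ) ≤ wordPerm hk l (i + 1) := by linarith
  exact_mod_cast this

theorem wordPerm_sub_le_of_below {k m : ℕ} (hk : 1 ≤ k) (l : List (Fin (k + 1))) (w : W k)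
    (hl : (l.map (gen k)).prod = w) (hbelow : alcove k w ⊆ below k m) :
    wordPerm hk l k - wordPerm hk l 0 ≤ (k + 1) * m := by
  have h := hbelow (Set.mem_image_of_mem _ (barycentre_mem k))
  have : (0 : ℝ) < k + 1 := by positivity
  rw [below, Set.mem_ofPred_eq, form_highestRoot_eq_coord, coord_inv_barycentre hk l w hl,
    coord_inv_barycentre hk l w hl, ← sub_div, div_le_iff₀ this] at h
  have : (wordPerm hk l k - wordPerm hk l 0 : ℝ) ≤ (k + 1) * m := by linarith
  exact_mod_cast this

end AffineA

/-! ### Maya diagrams; adding and removing cells as bead moves -/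

namespace KBounded

open AffineA

/-- The position of the bead of row `a` in the Maya diagram of `μ`. -/
def bead (μ : YoungDiagram) (a : ℕ) : ℤ := μ.rowLen a - a - 1

/-- The integer `x` is the position of a bead of `μ`. -/
def IsBead (μ : YoungDiagram) (x : ℤ) : Prop := ∃ a, bead μ a = x

theorem bead_strictAnti (μ : YoungDiagram) : StrictAnti (bead μ) := by
  intro a b hab
  have := μ.rowLen_anti a b hab.le
  unfold bead
  omega

theorem rowLen_bot (a : ℕ) : (⊥ : YoungDiagram).rowLen a = 0 := by
  by_contra h
  exact YoungDiagram.notMem_bot _ (YoungDiagram.mem_iff_lt_rowLen.2 (Nat.pos_of_ne_zero h))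

theorem colLen_bot (b : ℕ) : (⊥ : YoungDiagram).colLen b = 0 := by
  by_contra h
  exact YoungDiagram.notMem_bot _ (YoungDiagram.mem_iff_lt_colLen.2 (Nat.pos_of_ne_zero h))

theorem isBead_bot (x : ℤ) : IsBead ⊥ x ↔ x < 0 := by
  simp only [IsBead, bead, rowLen_bot]
  constructor
  · rintro ⟨a, rfl⟩
    omega
  · intro h
    exact ⟨(-x - 1).toNat, by omega⟩

theorem rowLen_eq_of_mem_iff {μ : YoungDiagram} {a n : ℕ} (h : ∀ b, (a, b) ∈ μ ↔ b < n) :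
    μ.rowLen a = n := by
  have h1 := h n
  have h2 := h (μ.rowLen a)
  rw [YoungDiagram.mem_iff_lt_rowLen] at h1 h2
  omega

theorem hasResidue_iff {k : ℕ} {r : Fin (k + 1)} {c : ℕ × ℕ} :
    HasResidue k r c ↔ (k + 1 : ℤ) ∣ (c.2 : ℤ) - c.1 - r := by
  unfold HasResidue
  rw [Int.modEq_comm, Int.modEq_iff_dvd]

/-- Adding a cell to row a moves its bead one step up, which is possible exactly when that position
is free. -/
theorem mem_addable_iff {μ : YoungDiagram} {a b : ℕ} :
    (a, b) ∈ addable μ ↔ b = μ.rowLen a ∧ ¬ IsBead μ (bead μ a + 1) := by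
  rw [mem_addable]
  constructor
  · rintro ⟨hn, hl⟩
    rw [YoungDiagram.mem_iff_lt_rowLen] at hn
    have hb : b = μ.rowLen a := by
      by_contra hne
      have h1 := hl (show ((a, b - 1) : ℕ × ℕ) ≤ (a, b) from ⟨le_rfl, by simp⟩)
        (Set.mem_insert _ _)
      rcases h1 with h1 | h1
      · have := congrArg Prod.snd h1
        simp at this
        omega
      · have h2 : (a, b - 1) ∈ μ := h1
        rw [YoungDiagram.mem_iff_lt_rowLen] at h2
        omega
    refine ⟨hb, ?_⟩
    rintro ⟨c, hc⟩
    have hca : c < a := by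
      by_contra hca
      have := (bead_strictAnti μ).antitone (not_lt.1 hca)
      omega
    have h1 := hl (show ((a - 1, b) : ℕ × ℕ) ≤ (a, b) from ⟨by simp, le_rfl⟩)
      (Set.mem_insert _ _)
    rcases h1 with h1 | h1
    · have := congrArg Prod.fst h1
      simp at this
      omega
    · have h2 : (a - 1, b) ∈ μ := h1
      rw [YoungDiagram.mem_iff_lt_rowLen] at h2
      have := (bead_strictAnti μ).antitone (show c ≤ a - 1 by omega)
      unfold bead at *
      omega
  · rintro ⟨rfl, hb⟩
    rw [YoungDiagram.mem_iff_lt_rowLen]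
    refine ⟨lt_irrefl _, ?_⟩
    rintro y ⟨c, d⟩ hxy hy
    rcases hy with rfl | hy
    · obtain ⟨hc, hd⟩ := hxy
      simp only at hc hd
      rcases hc.eq_or_lt with rfl | hc
      · rcases hd.eq_or_lt with rfl | hd
        · exact Set.mem_insert _ _
        · exact Or.inr (YoungDiagram.mem_iff_lt_rowLen.2 hd)
      · refine Or.inr (YoungDiagram.mem_iff_lt_rowLen.2 ?_)
        by_contra hlt
        have h1 := μ.rowLen_anti c (a - 1) (by omega)
        have h2 := μ.rowLen_anti (a - 1) a (by omega)
        refine hb ⟨a - 1, ?_⟩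
        unfold bead
        omega
    · exact Or.inr (μ.isLowerSet hxy hy)

theorem mem_removable_iff {μ : YoungDiagram} {a b : ℕ} :
    (a, b) ∈ removable μ ↔ b + 1 = μ.rowLen a ∧ ¬ IsBead μ (bead μ a - 1) := by
  classical
  rw [removable, Finset.mem_filter, YoungDiagram.mem_cells, YoungDiagram.mem_iff_lt_rowLen]
  constructor
  · rintro ⟨hn, hl⟩
    have key : ∀ c d, a ≤ c → b ≤ d → (c, d) ≠ (a, b) → μ.rowLen c ≤ d := by
      intro c d hc hd hne
      by_contra hlt
      have hm : (c, d) ∈ μ := YoungDiagram.mem_iff_lt_rowLen.2 (not_le.1 hlt)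
      exact (hl (show ((a, b) : ℕ × ℕ) ≤ (c, d) from ⟨hc, hd⟩) ⟨hm, hne⟩).2 rfl
    have h1 := key a (b + 1) le_rfl (by omega) (by simp)
    have h2 := key (a + 1) b (by omega) le_rfl (by simp)
    refine ⟨by omega, ?_⟩
    rintro ⟨c, hc⟩
    have hca : a + 1 ≤ c := by
      by_contra hca
      have := (bead_strictAnti μ).antitone (show c ≤ a by omega)
      omega
    have := (bead_strictAnti μ).antitone hca
    unfold bead at *
    omega
  · rintro ⟨h1, hb⟩
    refine ⟨by omega, ?_⟩
    rintro ⟨c, d⟩ y hxy ⟨hy, hne⟩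
    refine ⟨μ.isLowerSet hxy hy, ?_⟩
    rintro rfl
    obtain ⟨hc, hd⟩ := hxy
    simp only at hc hd
    have hy' : d < μ.rowLen c := YoungDiagram.mem_iff_lt_rowLen.1 hy
    rcases hc.eq_or_lt with rfl | hc
    · exact hne (by simp; omega)
    · have h2 := μ.rowLen_anti (a + 1) c hc
      have h3 := μ.rowLen_anti a (a + 1) (by omega)
      refine hb ⟨a + 1, ?_⟩
      unfold bead
      push_cast
      omega

open Classical in
theorem bead_addAll (k : ℕ) (r : Fin (k + 1)) (μ : YoungDiagram) (a : ℕ) :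
    bead (addAll k r μ) a =
      if (k + 1 : ℤ) ∣ bead μ a + 1 - r ∧ ¬ IsBead μ (bead μ a + 1) then bead μ a + 1
      else bead μ a := by
  have hmem : ∀ b, (a, b) ∈ addAll k r μ ↔ b < μ.rowLen a ∨ (b = μ.rowLen a ∧
      (k + 1 : ℤ) ∣ bead μ a + 1 - r ∧ ¬ IsBead μ (bead μ a + 1)) := by
    intro b
    rw [← YoungDiagram.mem_cells]
    simp only [addAll, addableRes, Finset.mem_union, Finset.mem_filter, mem_addable_iff,
      YoungDiagram.mem_cells, YoungDiagram.mem_iff_lt_rowLen, hasResidue_iff]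
    refine or_congr Iff.rfl ?_
    constructor
    · rintro ⟨⟨rfl, h⟩, h'⟩
      exact ⟨rfl, by simpa [bead] using h', h⟩
    · rintro ⟨rfl, h', h⟩
      exact ⟨⟨rfl, h⟩, by simpa [bead] using h'⟩
  split_ifs with h
  · have : (addAll k r μ).rowLen a = μ.rowLen a + 1 :=
      rowLen_eq_of_mem_iff fun b => by rw [hmem]; simp only [h, and_true, not_false_eq_true]; omega
    simp only [bead, this]
    push_cast
    ring
  · have : (addAll k r μ).rowLen a = μ.rowLen a :=
      rowLen_eq_of_mem_iff fun b => by rw [hmem]; simp only [h, and_false, or_false]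
    simp only [bead, this]

open Classical in
theorem bead_removeAll (k : ℕ) (r : Fin (k + 1)) (μ : YoungDiagram) (a : ℕ) :
    bead (removeAll k r μ) a =
      if (k + 1 : ℤ) ∣ bead μ a - r ∧ ¬ IsBead μ (bead μ a - 1) then bead μ a - 1
      else bead μ a := by
  have hmem : ∀ b, (a, b) ∈ removeAll k r μ ↔ b < μ.rowLen a ∧ ¬ (b + 1 = μ.rowLen a ∧
      (k + 1 : ℤ) ∣ bead μ a - r ∧ ¬ IsBead μ (bead μ a - 1)) := by
    intro b
    rw [← YoungDiagram.mem_cells]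
    simp only [removeAll, removableRes, Finset.mem_sdiff, Finset.mem_filter, mem_removable_iff,
      YoungDiagram.mem_cells, YoungDiagram.mem_iff_lt_rowLen, hasResidue_iff]
    refine and_congr Iff.rfl (not_congr ?_)
    have hb : b + 1 = μ.rowLen a → (b : ℤ) - a - r = bead μ a - r := by
      intro h
      simp only [bead, ← h]
      push_cast
      ring
    constructor
    · rintro ⟨⟨h1, h⟩, h'⟩
      exact ⟨h1, hb h1 ▸ h', h⟩
    · rintro ⟨h1, h', h⟩
      exact ⟨⟨h1, h⟩, (hb h1).symm ▸ h'⟩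
  split_ifs with h
  · have hpos : 0 < μ.rowLen a := by
      by_contra h0
      refine h.2 ⟨a + 1, ?_⟩
      have := μ.rowLen_anti a (a + 1) (by omega)
      unfold bead
      push_cast
      omega
    have : (removeAll k r μ).rowLen a = μ.rowLen a - 1 :=
      rowLen_eq_of_mem_iff fun b => by rw [hmem]; simp only [h, and_true, not_false_eq_true]; omega
    simp only [bead, this]
    omega
  · have : (removeAll k r μ).rowLen a = μ.rowLen a :=
      rowLen_eq_of_mem_iff fun b => by rw [hmem]; simp only [h, and_false, not_false_eq_true,
        and_true]
    simp only [bead, this]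

theorem addableRes_nonempty_iff {k : ℕ} {r : Fin (k + 1)} {μ : YoungDiagram} :
    (addableRes k r μ).Nonempty ↔
      ∃ x, IsBead μ x ∧ ¬ IsBead μ (x + 1) ∧ (k + 1 : ℤ) ∣ x + 1 - r := by
  simp only [Finset.Nonempty, addableRes, Finset.mem_filter, hasResidue_iff, Prod.exists,
    mem_addable_iff]
  constructor
  · rintro ⟨a, b, ⟨rfl, h⟩, h'⟩
    exact ⟨_, ⟨a, rfl⟩, h, by simpa [bead] using h'⟩
  · rintro ⟨_, ⟨a, rfl⟩, h, h'⟩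
    exact ⟨a, _, ⟨rfl, h⟩, by simpa [bead] using h'⟩

/-- The hypothesis excludes removable cells of residue r: a pair (x - 1, x) with x ≡ r is then full,
empty, or has its only bead at x - 1, so moving the free beads up is the full exchange. -/
theorem isBead_addAll {k : ℕ} (hk : 1 ≤ k) {r : Fin (k + 1)} {μ : YoungDiagram}
    (h : ∀ x, (k + 1 : ℤ) ∣ x - r → IsBead μ x → IsBead μ (x - 1)) (x : ℤ) :
    IsBead (addAll k r μ) x ↔ IsBead μ (swapFun k r x) := by
  by_cases h1 : (k + 1 : ℤ) ∣ x - r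
  · rw [swapFun_of_dvd h1]
    constructor
    · rintro ⟨a, ha⟩
      rw [bead_addAll] at ha
      split_ifs at ha with hc
      · exact ⟨a, by omega⟩
      · exact h x h1 ⟨a, ha⟩
    · intro hx
      by_cases hx' : IsBead μ x
      · obtain ⟨a, rfl⟩ := hx'
        refine ⟨a, ?_⟩
        rw [bead_addAll, if_neg]
        rintro ⟨h2, -⟩
        rw [← sub_add_eq_add_sub] at h2
        exact not_dvd_of_dvd_add_one hk h2 h1
      · obtain ⟨a, ha⟩ := hx
        refine ⟨a, ?_⟩
        rw [bead_addAll, ha, sub_add_cancel, if_pos ⟨h1, hx'⟩]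
  by_cases h2 : (k + 1 : ℤ) ∣ x + 1 - r
  · rw [swapFun_of_dvd_add_one hk h2]
    constructor
    · rintro ⟨a, ha⟩
      rw [bead_addAll] at ha
      split_ifs at ha with hc
      · rw [ha] at hc
        exact absurd hc.1 h1
      · rw [ha] at hc
        by_contra hx
        exact hc ⟨h2, hx⟩
    · intro hx
      have hx' := h _ h2 hx
      rw [add_sub_cancel_right] at hx'
      obtain ⟨a, rfl⟩ := hx'
      exact ⟨a, by rw [bead_addAll, if_neg fun hc => hc.2 hx]⟩
  · rw [swapFun_of_not_dvd h1 h2]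
    constructor
    · rintro ⟨a, ha⟩
      rw [bead_addAll] at ha
      split_ifs at ha with hc
      · rw [ha] at hc
        exact absurd hc.1 h1
      · exact ⟨a, ha⟩
    · rintro ⟨a, rfl⟩
      exact ⟨a, by rw [bead_addAll, if_neg fun hc => h2 hc.1]⟩

/-- Mirror image of `isBead_addAll`: here the hypothesis excludes addable cells of residue r. -/
theorem isBead_removeAll {k : ℕ} (hk : 1 ≤ k) {r : Fin (k + 1)} {μ : YoungDiagram}
    (h : ∀ x, (k + 1 : ℤ) ∣ x + 1 - r → IsBead μ x → IsBead μ (x + 1)) (x : ℤ) :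
    IsBead (removeAll k r μ) x ↔ IsBead μ (swapFun k r x) := by
  by_cases h1 : (k + 1 : ℤ) ∣ x - r
  · rw [swapFun_of_dvd h1]
    constructor
    · rintro ⟨a, ha⟩
      rw [bead_removeAll] at ha
      split_ifs at ha with hc
      · rw [show bead μ a = x + 1 by omega, ← sub_add_eq_add_sub] at hc
        exact absurd h1 (not_dvd_of_dvd_add_one hk hc.1)
      · rw [ha] at hc
        by_contra hx
        exact hc ⟨h1, hx⟩
    · intro hx
      have hx' := h _ (by rwa [sub_add_cancel]) hx
      rw [sub_add_cancel] at hx'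
      obtain ⟨a, rfl⟩ := hx'
      exact ⟨a, by rw [bead_removeAll, if_neg fun hc => hc.2 hx]⟩
  by_cases h2 : (k + 1 : ℤ) ∣ x + 1 - r
  · rw [swapFun_of_dvd_add_one hk h2]
    constructor
    · rintro ⟨a, ha⟩
      rw [bead_removeAll] at ha
      split_ifs at ha with hc
      · exact ⟨a, by omega⟩
      · exact h x h2 ⟨a, ha⟩
    · intro hx
      by_cases hx' : IsBead μ x
      · obtain ⟨a, rfl⟩ := hx'
        exact ⟨a, by rw [bead_removeAll, if_neg fun hc => h1 hc.1]⟩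
      · obtain ⟨a, ha⟩ := hx
        refine ⟨a, ?_⟩
        rw [bead_removeAll, ha, add_sub_cancel_right, if_pos ⟨h2, hx'⟩]
  · rw [swapFun_of_not_dvd h1 h2]
    constructor
    · rintro ⟨a, ha⟩
      rw [bead_removeAll] at ha
      split_ifs at ha with hc
      · rw [show bead μ a = x + 1 by omega] at hc
        exact absurd hc.1 h2
      · exact ⟨a, ha⟩
    · rintro ⟨a, rfl⟩
      exact ⟨a, by rw [bead_removeAll, if_neg fun hc => h1 hc.1]⟩

/-- On the Maya diagram of a core, the generator `s_r` acts by exchanging neighbouring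
positions. -/
theorem isBead_coreGen {k : ℕ} (hk : 1 ≤ k) (r : Fin (k + 1)) {μ : YoungDiagram}
    (hμ : ∀ x (q : ℕ), IsBead μ x → IsBead μ (x - (k + 1) * q)) (x : ℤ) :
    IsBead (coreGen k r μ) x ↔ IsBead μ (swapFun k r x) := by
  unfold coreGen
  split_ifs with h
  · refine isBead_addAll hk (fun y hy hb => ?_) x
    -- An addable cell z → z + 1 rules out removable ones of the same residue. For a bead y ≡ z + 1,
    -- if y ≤ z + 1 then y - 1 lies whole periods below the bead z; otherwise the gap z + 1 would
    -- lie whole periods below the bead y.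
    obtain ⟨z, hz, hz', hd⟩ := addableRes_nonempty_iff.1 h
    obtain ⟨q, hq⟩ : (k + 1 : ℤ) ∣ (z + 1) - y := by
      have := dvd_sub hd hy
      rwa [sub_sub_sub_cancel_right] at this
    rcases le_total 0 q with h0 | h0
    · lift q to ℕ using h0
      have := hμ z q hz
      rwa [← hq, show z - (z + 1 - y) = y - 1 by ring] at this
    · obtain ⟨t, rfl⟩ := Int.exists_eq_neg_ofNat h0
      have := hμ y t hb
      rw [show y - (k + 1) * (t : ℤ) = z + 1 by linarith] at this
      exact absurd this hz'
  · refine isBead_removeAll hk (fun y hy hb => ?_) x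
    by_contra hn
    exact h (addableRes_nonempty_iff.2 ⟨y, hb, hn, hy⟩)

theorem wordPerm_symm_sub_mul {k : ℕ} (hk : 1 ≤ k) (l : List (Fin (k + 1))) (x q : ℤ) :
    (wordPerm hk l).symm (x - (k + 1) * q) = (wordPerm hk l).symm x - (k + 1) * q := by
  have h := wordPerm_add_mul hk l ((wordPerm hk l).symm x) (-q)
  rw [Equiv.apply_symm_apply, mul_neg, ← sub_eq_add_neg, ← sub_eq_add_neg] at h
  rw [Equiv.symm_apply_eq, h]

/-- The beads of the core `w ∅` are the images of the negative integers under the affine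
permutation `w`. -/
theorem isBead_foldr {k : ℕ} (hk : 1 ≤ k) (l : List (Fin (k + 1))) (x : ℤ) :
    IsBead (l.foldr (coreGen k) ⊥) x ↔ (wordPerm hk l).symm x < 0 := by
  induction l generalizing x with
  | nil => exact isBead_bot x
  | cons r l ih =>
    have hs : (wordPerm hk (r :: l)).symm x = (wordPerm hk l).symm (swapFun k r x) := by
      rw [Equiv.symm_apply_eq, wordPerm_cons, Equiv.apply_symm_apply, swapFun_involutive hk]
    rw [List.foldr_cons, isBead_coreGen hk, ih, hs]
    intro y q hy
    rw [ih] at hy ⊢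
    rw [wordPerm_symm_sub_mul]
    have : (0 : ℤ) ≤ (k + 1) * q := by positivity
    omega

/-! ### Hooks, gaps and the bound on the columns of λ -/

/-- Columns label gaps as rows label beads: the bead of row a lies above this position if (a, b) is
a cell, and below it otherwise. -/
theorem not_isBead_sub_colLen (μ : YoungDiagram) (b : ℕ) : ¬ IsBead μ (b - μ.colLen b) := by
  rintro ⟨a, ha⟩
  have h : a < μ.colLen b ↔ b < μ.rowLen a := by
    rw [← YoungDiagram.mem_iff_lt_colLen, YoungDiagram.mem_iff_lt_rowLen]
  unfold bead at ha
  omega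

/-- Every integer is u(i) + (k + 1)q with 0 ≤ i ≤ k; by `isBead_foldr`, it is a bead exactly when q
< 0. -/
theorem wordPerm_emod {k : ℕ} (hk : 1 ≤ k) (l : List (Fin (k + 1))) (x : ℤ) :
    wordPerm hk l ((wordPerm hk l).symm x % (k + 1)) =
      x - (k + 1) * ((wordPerm hk l).symm x / (k + 1)) := by
  have h := wordPerm_add_mul hk l ((wordPerm hk l).symm x % (k + 1))
    ((wordPerm hk l).symm x / (k + 1))
  rw [Int.emod_add_mul_ediv, Equiv.apply_symm_apply] at h
  omega

theorem shortHooks_le_card {k : ℕ} (hk : 1 ≤ k) {l : List (Fin (k + 1))} {μ : YoungDiagram}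
    (hμ : ∀ x, IsBead μ x ↔ (wordPerm hk l).symm x < 0) (a : ℕ) :
    shortHooks k μ a ≤
      ((Finset.range (k + 1)).filter fun i : ℕ => wordPerm hk l i < bead μ a).card := by
  have hn : (0 : ℤ) < k + 1 := by omega
  -- The hook length of a cell is the distance from the gap of its column up to the bead of its row.
  have hgap : ∀ b ∈ (Finset.range (μ.rowLen a)).filter fun b => hook μ a b < k + 1,
      (b : ℤ) - μ.colLen b < bead μ a ∧ bead μ a - (k + 1) < (b : ℤ) - μ.colLen b := by
    intro b hb
    rw [Finset.mem_filter, Finset.mem_range, hook] at hb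
    have : a < μ.colLen b := by
      rw [← YoungDiagram.mem_iff_lt_colLen, YoungDiagram.mem_iff_lt_rowLen]
      exact hb.1
    unfold bead
    omega
  -- Send a gap to the index i of its class; as a gap it has q ≥ 0, so u(i) is at most the gap,
  -- hence below the bead.
  refine Finset.card_le_card_of_injOn
    (fun b => ((wordPerm hk l).symm (b - μ.colLen b) % (k + 1)).toNat) ?_ ?_
  · intro b hb
    have h0 := Int.emod_nonneg ((wordPerm hk l).symm (b - μ.colLen b)) hn.ne'
    have h1 := Int.emod_lt_of_pos ((wordPerm hk l).symm (b - μ.colLen b)) hn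
    have h2 := not_isBead_sub_colLen μ b
    rw [hμ, not_lt] at h2
    have h3 := mul_nonneg hn.le (Int.ediv_nonneg h2 hn.le)
    have h4 := hgap b hb
    simp only [Finset.coe_filter, Finset.mem_range, Set.mem_ofPred_eq, Int.toNat_of_nonneg h0,
      wordPerm_emod]
    omega
  · intro b hb c hc hbc
    have h0 := fun x => Int.emod_nonneg ((wordPerm hk l).symm x) hn.ne'
    have hbc' : (wordPerm hk l).symm (b - μ.colLen b) % (k + 1) =
        (wordPerm hk l).symm (c - μ.colLen c) % (k + 1) := by
      rw [← Int.toNat_of_nonneg (h0 _), ← Int.toNat_of_nonneg (h0 (c - μ.colLen c))]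
      exact congrArg _ hbc
    have h1 := wordPerm_emod hk l (b - μ.colLen b)
    rw [hbc', wordPerm_emod] at h1
    have h2 : (k + 1 : ℤ) ∣ ((b : ℤ) - μ.colLen b) - (c - μ.colLen c) := by
      refine ⟨(wordPerm hk l).symm (b - μ.colLen b) / (k + 1) -
        (wordPerm hk l).symm (c - μ.colLen c) / (k + 1), ?_⟩
      rw [mul_sub]
      omega
    have h3 := hgap b hb
    have h4 := hgap c hc
    -- Two gaps in a window shorter than a period and in the same class coincide; gap positions
    -- strictly increase with the column.
    rw [dvd_iff_eq_zero (by omega) (by omega)] at h2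
    rcases lt_trichotomy b c with h | h | h
    · have := μ.colLen_anti b c h.le
      omega
    · exact h
    · have := μ.colLen_anti c b h.le
      omega

/-- By monotonicity the indices i with u(i) below the bead form an initial segment, which here has
more than b elements. -/
theorem lt_bead_of_lt_shortHooks {k : ℕ} (hk : 1 ≤ k) {l : List (Fin (k + 1))} {μ : YoungDiagram}
    (hμ : ∀ x, IsBead μ x ↔ (wordPerm hk l).symm x < 0)
    (hmono : ∀ i j : ℕ, i ≤ j → j ≤ k → wordPerm hk l i ≤ wordPerm hk l j)
    {a b : ℕ} (hab : b < shortHooks k μ a) : wordPerm hk l b < bead μ a := by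
  by_contra hlt
  refine absurd (hab.trans_le (shortHooks_le_card hk hμ a)) (not_lt.2 ?_)
  refine (Finset.card_le_card (t := Finset.range b) fun i hi => ?_).trans_eq (Finset.card_range b)
  simp only [Finset.mem_filter, Finset.mem_range] at hi ⊢
  by_contra hib
  have := hmono b i (by omega) (by omega)
  omega

theorem colLen_le_sum {k : ℕ} (hk : 1 ≤ k) {l : List (Fin (k + 1))} {lam μ : YoungDiagram}
    (hμ : ∀ x, IsBead μ x ↔ (wordPerm hk l).symm x < 0)
    (hmono : ∀ i j : ℕ, i ≤ j → j ≤ k → wordPerm hk l i ≤ wordPerm hk l j)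
    (hlam : ∀ a, lam.rowLen a = shortHooks k μ a) {b : ℕ} (hb : b ≤ k) :
    lam.colLen b ≤ ∑ i ∈ Finset.Ioc b k,
      ((wordPerm hk l i - wordPerm hk l b) / (k + 1)).toNat := by
  have hn : (0 : ℤ) < k + 1 := by omega
  -- Beads have the form u(i) - (k + 1)t with t ≥ 1; one above u(b) needs i > b and t at most the
  -- floor used here.
  let S : Finset ℤ := (Finset.Ioc b k).biUnion fun i =>
    (Finset.Icc 1 ((wordPerm hk l i - wordPerm hk l b) / (k + 1))).image
      fun t => wordPerm hk l i - (k + 1) * t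
  calc lam.colLen b = (Finset.range (lam.colLen b)).card := (Finset.card_range _).symm
    _ ≤ S.card := by
      refine Finset.card_le_card_of_injOn (bead μ) ?_ (bead_strictAnti μ).injective.injOn
      intro a ha
      have h1 : wordPerm hk l b < bead μ a := by
        apply lt_bead_of_lt_shortHooks hk hμ hmono
        rw [← hlam, ← YoungDiagram.mem_iff_lt_rowLen, YoungDiagram.mem_iff_lt_colLen]
        simpa using ha
      have h2 : (wordPerm hk l).symm (bead μ a) < 0 := (hμ _).1 ⟨a, rfl⟩
      have h3 := wordPerm_emod hk l (bead μ a)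
      have h4 := Int.emod_nonneg ((wordPerm hk l).symm (bead μ a)) hn.ne'
      have h5 := Int.emod_lt_of_pos ((wordPerm hk l).symm (bead μ a)) hn
      have h6 : (wordPerm hk l).symm (bead μ a) / (k + 1) < 0 := Int.ediv_neg_of_neg_of_pos h2 hn
      generalize (wordPerm hk l).symm (bead μ a) % (k + 1) = i at h3 h4 h5
      generalize (wordPerm hk l).symm (bead μ a) / (k + 1) = q at h3 h6
      lift i to ℕ using h4
      have h7 : (k + 1 : ℤ) * q < 0 := mul_neg_of_pos_of_neg hn h6
      simp only [S, Finset.coe_biUnion, Set.mem_iUnion, Finset.mem_coe, Finset.mem_image,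
        Finset.mem_Icc, Finset.mem_Ioc]
      refine ⟨i, ⟨?_, by omega⟩, -q, ⟨by omega, ?_⟩, ?_⟩
      · by_contra hib
        have := hmono i b (by omega) hb
        omega
      · rw [Int.le_ediv_iff_mul_le hn, mul_comm, mul_neg]
        omega
      · rw [mul_neg]
        omega
    _ ≤ ∑ i ∈ Finset.Ioc b k, ((Finset.Icc 1 ((wordPerm hk l i - wordPerm hk l b) /
          (k + 1))).image fun t => wordPerm hk l i - (k + 1) * t).card := Finset.card_biUnion_le
    _ ≤ _ := Finset.sum_le_sum fun i _ => Finset.card_image_le.trans (by simp)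

/-! ### Choice of the rectangles -/

/-- Rectangle indices `i_t = min k #{j ≤ k | F j ≤ t}` whose union has columns long enough. -/
theorem exists_rect_indices {k M : ℕ} (hk : 1 ≤ k) (F : ℕ → ℕ)
    (hmono : ∀ i j, i ≤ j → j ≤ k → F i ≤ F j) (h0 : F 0 = 0) (hM : F k ≤ M) :
    ∃ i : Fin M → ℕ, (∀ t, 1 ≤ i t ∧ i t ≤ k) ∧ ∀ b < k,
      ∑ j ∈ Finset.Ioc b k, (F j - F b) ≤ ∑ t, if b < i t then k + 1 - i t else 0 := by
  let N : ℕ → ℕ := fun t => ((Finset.range (k + 1)).filter fun j => F j ≤ t).card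
  have hN : ∀ t b, b ≤ k → F b ≤ t → b + 1 ≤ N t := by
    intro t b hb ht
    rw [← Finset.card_range (b + 1)]
    refine Finset.card_le_card fun j hj => ?_
    simp only [Finset.mem_filter, Finset.mem_range] at hj ⊢
    exact ⟨by omega, (hmono j b (by omega) hb).trans ht⟩
  -- At levels t ≥ F k all k + 1 indices are counted, and the cap keeps the width admissible; it is
  -- harmless since b < k.
  refine ⟨fun t => min k (N t), fun t => ⟨?_, min_le_left _ _⟩, fun b hb => ?_⟩
  · exact le_min hk (hN t 0 (by omega) (by omega))
  · calc ∑ j ∈ Finset.Ioc b k, (F j - F b)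
        -- F j - F b counts the levels t with F b ≤ t < F j.
        = ∑ j ∈ Finset.Ioc b k, ∑ t ∈ Finset.range M, if F b ≤ t ∧ t < F j then 1 else 0 := by
          refine Finset.sum_congr rfl fun j hj => ?_
          rw [Finset.mem_Ioc] at hj
          rw [← Finset.card_filter, ← Nat.card_Ico]
          congr 1
          ext t
          have := hmono j k hj.2 le_rfl
          simp only [Finset.mem_Ico, Finset.mem_filter, Finset.mem_range]
          omega
      _ = ∑ t ∈ Finset.range M, ∑ j ∈ Finset.Ioc b k, if F b ≤ t ∧ t < F j then 1 else 0 :=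
          Finset.sum_comm
      _ ≤ ∑ t ∈ Finset.range M, if b < min k (N t) then k + 1 - min k (N t) else 0 := by
          refine Finset.sum_le_sum fun t _ => ?_
          by_cases hbt : F b ≤ t
          -- At level t at most k + 1 - N t indices j contribute, which is at most the height of the
          -- chosen rectangle.
          · rw [if_pos (lt_min hb (hN t b hb.le hbt)), ← Finset.card_filter]
            have hc := Finset.card_filter_add_card_filter_not (s := Finset.range (k + 1))
              fun j => F j ≤ t
            rw [Finset.card_range] at hc
            have : ((Finset.Ioc b k).filter fun j => F b ≤ t ∧ t < F j).card ≤
                ((Finset.range (k + 1)).filter fun j => ¬ F j ≤ t).card := by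
              refine Finset.card_le_card fun j hj => ?_
              simp only [Finset.mem_filter, Finset.mem_range, Finset.mem_Ioc] at hj ⊢
              omega
            have := min_le_right k (N t)
            simp only [N] at this ⊢
            omega
          · simp [hbt]
      _ = _ := (Fin.sum_univ_eq_sum_range
          (fun t => if b < min k (N t) then k + 1 - min k (N t) else 0) M).symm

/-! ### Column lengths of unions of rectangles -/

theorem colLen_eq_of_mem_iff {μ : YoungDiagram} {b n : ℕ} (h : ∀ a, (a, b) ∈ μ ↔ a < n) :
    μ.colLen b = n := by
  have h1 := h n
  have h2 := h (μ.colLen b)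
  rw [YoungDiagram.mem_iff_lt_colLen] at h1 h2
  omega

theorem colLen_rect (k i b : ℕ) : (rect k i).colLen b = if b < i then k + 1 - i else 0 := by
  refine colLen_eq_of_mem_iff fun a => ?_
  rw [← YoungDiagram.mem_cells]
  simp only [rect, Finset.mem_product, Finset.mem_range]
  split_ifs <;> omega

theorem colLen_eq_countP (μ : YoungDiagram) (b : ℕ) :
    μ.colLen b = μ.rowLens.countP (b < ·) := by
  have h : μ.rowLens.countP (b < ·) =
      ((Finset.range (μ.colLen 0)).filter (b < μ.rowLen ·)).card := by
    rw [YoungDiagram.rowLens, List.countP_map, Finset.card_def, Finset.filter_val,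
      ← Multiset.countP_eq_card_filter, Finset.range_val, Multiset.range, Multiset.coe_countP]
    rfl
  rw [h, ← Finset.card_range (μ.colLen b)]
  congr 1
  ext a
  have := μ.colLen_anti 0 b (Nat.zero_le _)
  simp only [Finset.mem_filter, Finset.mem_range, ← YoungDiagram.mem_iff_lt_rowLen,
    YoungDiagram.mem_iff_lt_colLen]
  omega

/-- A column length counts the parts exceeding b, and the union concatenates the parts up to order.
-/
theorem colLen_union (lam mu : YoungDiagram) (b : ℕ) :
    (union lam mu).colLen b = lam.colLen b + mu.colLen b := by
  have hp : (Multiset.sort (lam.rowLens + mu.rowLens : Multiset ℕ) (· ≥ ·)).Perm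
      (lam.rowLens ++ mu.rowLens) := by
    rw [← Multiset.coe_eq_coe, Multiset.sort_eq, Multiset.coe_add]
  rw [colLen_eq_countP, union, YoungDiagram.rowLens_ofRowLens_eq_self, hp.countP_eq,
    List.countP_append, ← colLen_eq_countP, ← colLen_eq_countP]
  intro x hx
  rw [hp.mem_iff, List.mem_append] at hx
  exact hx.elim (lam.pos_of_mem_rowLens x) (mu.pos_of_mem_rowLens x)

theorem colLen_rectUnion (k : ℕ) {n : ℕ} (i : Fin n → ℕ) (b : ℕ) :
    (rectUnion k i).colLen b = ∑ t, if b < i t then k + 1 - i t else 0 := by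
  have h : ∀ L : List YoungDiagram,
      (L.foldr union ⊥).colLen b = (L.map fun μ => μ.colLen b).sum := by
    intro L
    induction L with
    | nil => exact colLen_bot b
    | cons μ L ih => rw [List.foldr_cons, colLen_union, ih, List.map_cons, List.sum_cons]
  rw [rectUnion, h, List.map_ofFn, List.sum_ofFn]
  simp only [Function.comp_apply, colLen_rect]

theorem le_of_colLen_le {lam mu : YoungDiagram} (h : ∀ b, lam.colLen b ≤ mu.colLen b) :
    lam ≤ mu := by
  rintro ⟨a, b⟩ hab
  have hab : (a, b) ∈ lam := hab
  rw [YoungDiagram.mem_iff_lt_colLen] at hab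
  exact YoungDiagram.mem_iff_lt_colLen.2 (hab.trans_le (h b))

end KBounded
end

/-! ### The corollary -/

open AffineA KBounded in
theorem mainTheorem2 (k m : ℕ) (hk : 1 ≤ k) (hm : 1 ≤ m)
    (lam : YoungDiagram) (hlam : KBounded.IsKBounded k lam)
    (w : AffineA.W k) (hw : KBounded.CorrespondsTo k lam w)
    (hdom : AffineA.alcove k w ⊆ AffineA.dominantChamber k)
    (hbelow : AffineA.alcove k w ⊆ AffineA.below k m) :
    ∃ i : Fin (m - 1) → ℕ, (∀ j, 1 ≤ i j ∧ i j ≤ k) ∧ lam ≤ KBounded.rectUnion k i := by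
  obtain ⟨μ, ⟨l, hl, rfl⟩, hrow⟩ := hw
  have hn : (0 : ℤ) < k + 1 := by omega
  have hmono : ∀ i j : ℕ, i ≤ j → j ≤ k → wordPerm hk l i ≤ wordPerm hk l j := by
    intro i j hij
    induction j, hij using Nat.le_induction with
    | base => exact fun _ => le_rfl
    | succ j _ ih =>
      intro hj
      have := wordPerm_le_succ_of_dominant hk l w hl hdom ⟨j, by omega⟩
      push_cast
      exact (ih (by omega)).trans this
  have hdiv : (wordPerm hk l k - wordPerm hk l 0) / (k + 1) < m := by
    have hle := wordPerm_sub_le_of_below hk l w hl hbelow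
    -- Equality would give u((k + 1)m) = u(k), so k + 1 would divide k. This strictness saves one
    -- rectangle: m - 1 instead of m.
    refine Int.ediv_lt_of_lt_mul hn (lt_of_le_of_ne (by rwa [mul_comm]) fun heq => ?_)
    have h1 := wordPerm_add_mul hk l 0 m
    have h2 : wordPerm hk l (0 + (k + 1) * m) = wordPerm hk l k := by
      rw [h1, mul_comm]; omega
    have h3 := (wordPerm hk l).injective h2
    have h4 : (k + 1 : ℤ) ∣ k := ⟨m, by omega⟩
    rw [dvd_iff_eq_zero (by omega) le_rfl] at h4
    omega
  have hnonneg : ∀ j : ℕ, j ≤ k → 0 ≤ (wordPerm hk l j - wordPerm hk l 0) / (k + 1 : ℤ) :=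
    fun j hj => Int.ediv_nonneg (by have := hmono 0 j (by omega) hj; simpa using this) hn.le
  obtain ⟨i, hi, hsum⟩ := exists_rect_indices (M := m - 1) hk
    (fun j => ((wordPerm hk l j - wordPerm hk l 0) / (k + 1)).toNat)
    (fun i j hij hj => Int.toNat_le_toNat
      (Int.ediv_le_ediv hn (sub_le_sub_right (hmono i j hij hj) _)))
    (by simp) (by omega)
  refine ⟨i, hi, le_of_colLen_le fun b => ?_⟩
  rcases lt_or_ge b k with hb | hb
  · rw [colLen_rectUnion]
    refine (colLen_le_sum hk (isBead_foldr hk l) hmono hrow hb.le).trans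
      (le_trans (Finset.sum_le_sum fun j hj => ?_) (hsum b hb))
    rw [Finset.mem_Ioc] at hj
    have h1 := hnonneg b hb.le
    have h2 := hnonneg j hj.2
    -- Superadditivity of the floor bounds each term by F(j) - F(b).
    have h3 : (wordPerm hk l j - wordPerm hk l b) / (k + 1 : ℤ) +
        (wordPerm hk l b - wordPerm hk l 0) / (k + 1) ≤
          (wordPerm hk l j - wordPerm hk l 0) / (k + 1) := by
      rw [Int.le_ediv_iff_mul_le hn, add_mul]
      have h4 := Int.ediv_mul_le (wordPerm hk l j - wordPerm hk l b) hn.ne'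
      have h5 := Int.ediv_mul_le (wordPerm hk l b - wordPerm hk l 0) hn.ne'
      omega
    omega
  -- Columns are numbered from 0, so k-boundedness leaves none from k on.
  · have : lam.colLen b = 0 := by
      by_contra h0
      have := YoungDiagram.mem_iff_lt_rowLen.1
        (YoungDiagram.mem_iff_lt_colLen.2 (Nat.pos_of_ne_zero h0))
      have := hlam 0
      omega
    omega
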